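/- Let $\mu$ be an infinite cardinal and let $(Q,\leq)$ be a better-quasi-ordered set. For a quasi-ordered set $P$ write $|P|_\equiv$ for the number of classes of the equivalence relation "$p\leq p'$ and $p'\leq p$" on $P$, and suppose that $|Q|_\equiv=\mu$. For a cardinal $\kappa$ let $\mathcal P_{\leq\kappa}(Q)$ be the set of all subsets of $Q$ of size at most $\kappa$, quasi-ordered by: $A\leq B$ if there is an injective function $f\colon A\to B$ with $a\leq f(a)$ for all $a\in A$. Then $$|\mathcal P_{\leq\kappa}(Q)|_\equiv=\mu\qquad\text{for all cardinals }1\leq\kappa<\aleph_{\mu^+}.$$ Here a quasi-order $Q$ is a better-quasi-order (in the sense of Nash-Williams) if for every barrier $B$ and every map $f\colon B\to Q$ there are $s,t\in B$ with $s\mathrel{\triangleleft}t$ and $f(s)\leq f(t)$. A barrier is a set $B$ of nonempty finite subsets of $\mathbb N$ whose union $\bigcup B$ is infinite, such that every infinite subset of $\bigcup B$ has an initial segment in $B$ and no member of $B$ is a proper subset of another; and $s\mathrel{\triangleleft}t$ means that there are $m<n$ and $i_0<i_1<\dots<i_n$ with $s=\{i_0,\dots,i_m\}$ and $t=\{i_1,\dots,i_n\}$.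 -/

import Mathlib

open scoped Cardinal

universe u

/-- The finite set `s` is an initial segment of the set `X` of natural numbers. -/
def IsInitialSegment (s : Finset ℕ) (X : Set ℕ) : Prop :=
  (s : Set ℕ) ⊆ X ∧ ∀ x ∈ X, ∀ y ∈ s, x ≤ y → x ∈ s

/-- The union of all members of a family of finite sets of natural numbers. -/
def barrierBase (B : Set (Finset ℕ)) : Set ℕ :=
  {n | ∃ s ∈ B, n ∈ s}

/-- A barrier in the sense of Nash-Williams: a family `B` of nonempty finite sets of natural
numbers with infinite union such that every infinite subset of the union has an initial segment
in `B`, and no member of `B` is a proper subset of another one. -/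
structure IsBarrier (B : Set (Finset ℕ)) : Prop where
  nonempty_of_mem : ∀ s ∈ B, s.Nonempty
  base_infinite : (barrierBase B).Infinite
  exists_initialSegment : ∀ X : Set ℕ, X ⊆ barrierBase B → X.Infinite →
    ∃ s ∈ B, IsInitialSegment s X
  eq_of_subset : ∀ s ∈ B, ∀ t ∈ B, s ⊆ t → s = t

/-- The relation `s ◁ t`: there are `m < n` and `i₀ < i₁ < ⋯ < iₙ` with `s = {i₀, …, iₘ}` and
`t = {i₁, …, iₙ}`. Here `u = {i₀, …, iₙ}`. -/
def ShiftRel (s t : Finset ℕ) : Prop :=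
  ∃ (u : Finset ℕ) (hu : u.Nonempty),
    s.Nonempty ∧ IsInitialSegment s (u : Set ℕ) ∧ s ≠ u ∧ t = u.erase (u.min' hu)

/-- A quasi-order is a better-quasi-order (Nash-Williams) if for every map `f` from a barrier
to it there are members `s ◁ t` of the barrier with `f s ≤ f t`. -/
def IsBetterQuasiOrder (Q : Type*) [Preorder Q] : Prop :=
  ∀ B : Set (Finset ℕ), IsBarrier B → ∀ f : B → Q,
    ∃ s t : B, ShiftRel (s : Finset ℕ) (t : Finset ℕ) ∧ f s ≤ f t

/-- The number of classes of the equivalence relation `q ≤ q' ∧ q' ≤ q` on a quasi-order. -/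
noncomputable def numClasses (Q : Type u) [Preorder Q] : Cardinal.{u} :=
  #(Antisymmetrization Q (· ≤ ·))

/-- The subsets of `Q` of size at most `κ`. -/
@[ext]
structure SubsetsLE (Q : Type u) (κ : Cardinal.{u}) : Type u where
  carrier : Set Q
  card_le : #carrier ≤ κ

/-- The quasi-order on subsets: `A ≤ B` if there is an injective `f : A → B` with `a ≤ f a`
for all `a ∈ A`. -/
instance SubsetsLE.instPreorder (Q : Type u) [Preorder Q] (κ : Cardinal.{u}) :
    Preorder (SubsetsLE Q κ) where
  le A B := ∃ f : A.carrier → B.carrier, Function.Injective f ∧ ∀ a : A.carrier, (a : Q) ≤ (f a : Q)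
  le_refl A := ⟨id, Function.injective_id, fun _ => le_refl _⟩
  le_trans := by
    rintro A B C ⟨f, hf, hf'⟩ ⟨g, hg, hg'⟩
    exact ⟨g ∘ f, hg.comp hf, fun a => (hf' a).trans (hg' (f a))⟩

open Cardinal Order

/-! ### Well-quasi-orders -/

/-! Only the well-quasi-order property of `Q` is used. Let `P` be the quotient poset and `v : A → P`
the quotient map on a subset `A`. The class of `A` is determined by two data: `infUpCard v`, an
antitone function from `P` to the cardinals that are at most `κ` and zero or infinite, and the
finite multiset `finitePart v`. If these agree for `A` and `B`, an injection is built on each level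
set of `infUpCard` separately (`exists_injective_le_of_infUpCard_eq`). There are at most `μ`
admissible cardinals because `κ < ℵ_{μ⁺}`, and the epigraph of `infUpCard v` is an upper set of a
well-quasi-order, hence given by finitely many points. So at most `μ` codes occur; singletons give
the lower bound. -/

theorem isBarrier_singletons : IsBarrier {s : Finset ℕ | ∃ n, s = {n}} where
  nonempty_of_mem := by
    rintro s ⟨n, rfl⟩
    exact Finset.singleton_nonempty n
  base_infinite := by
    have : barrierBase {s : Finset ℕ | ∃ n, s = {n}} = Set.univ :=
      Set.eq_univ_of_forall fun n => ⟨{n}, ⟨n, rfl⟩, Finset.mem_singleton_self n⟩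
    rw [this]
    exact Set.infinite_univ
  exists_initialSegment := by
    intro X _ hX
    classical
    have hne := hX.nonempty
    refine ⟨{sInf X}, ⟨_, rfl⟩, ?_, ?_⟩
    · simpa using Nat.sInf_mem hne
    · intro x hx y hy hxy
      rw [Finset.mem_singleton] at hy ⊢
      exact le_antisymm (hy ▸ hxy) (Nat.sInf_le hx)
  eq_of_subset := by
    rintro s ⟨m, rfl⟩ t ⟨n, rfl⟩ h
    simpa using h

theorem ShiftRel.lt_of_singleton {m n : ℕ} (h : ShiftRel {m} {n}) : m < n := by
  obtain ⟨u, hu, -, ⟨hsub, hini⟩, -, ht⟩ := h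
  have hmu : m ∈ u := by simpa using hsub
  have hnu : n ∈ u.erase (u.min' hu) := ht ▸ Finset.mem_singleton_self n
  have hmin : u.min' hu = m := by
    simpa using hini (u.min' hu) (u.min'_mem hu) m (Finset.mem_singleton_self m)
      (u.min'_le m hmu)
  rw [hmin, Finset.mem_erase] at hnu
  exact lt_of_le_of_ne (hmin ▸ u.min'_le n hnu.2) hnu.1.symm

theorem IsBetterQuasiOrder.wellQuasiOrderedLE {Q : Type*} [Preorder Q]
    (hQ : IsBetterQuasiOrder Q) : WellQuasiOrderedLE Q := by
  refine ⟨fun f => ?_⟩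
  obtain ⟨⟨_, m, rfl⟩, ⟨_, n, rfl⟩, hst, hle⟩ :=
    hQ _ isBarrier_singletons fun s => f s.2.choose
  have key : ∀ k : ℕ, ∀ h : ∃ n, ({k} : Finset ℕ) = {n}, h.choose = k := fun k h =>
    (Finset.singleton_injective h.choose_spec).symm
  refine ⟨m, n, hst.lt_of_singleton, ?_⟩
  simpa only [key] using hle

/-- Every subset of a well-quasi-ordered set is dominated from below by a finite part of it. -/
theorem exists_finset_basis {P : Type*} [PartialOrder P] [WellQuasiOrderedLE P] (S : Set P) :
    ∃ T : Finset P, (T : Set P) ⊆ S ∧ ∀ s ∈ S, ∃ t ∈ T, t ≤ s := by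
  have hfin : {x | Minimal (· ∈ S) x}.Finite :=
    WellQuasiOrderedLE.finite_of_isAntichain (setOfPred_minimal_antichain (· ∈ S))
  refine ⟨hfin.toFinset, fun x hx => ?_, fun s hs => ?_⟩
  · exact (by simpa using hx : Minimal (· ∈ S) x).prop
  · obtain ⟨t, hts, ht⟩ := exists_minimal_le_of_wellFoundedLT (· ∈ S) s hs
    exact ⟨t, by simpa using ht, hts⟩

/-- An upper set is recovered from any finite basis of it. -/
theorem mk_upperSet_le {P : Type*} [PartialOrder P] [WellQuasiOrderedLE P] [Infinite P] :
    #(UpperSet P) ≤ #P := by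
  choose T hT hT' using fun S : Set P => exists_finset_basis S
  rw [← mk_finset_of_infinite P]
  refine mk_le_of_injective (f := fun U : UpperSet P => T U) fun U V h => ?_
  have key : ∀ U V : UpperSet P, T U = T V → ∀ x ∈ U, x ∈ V := by
    intro U V h x hx
    obtain ⟨t, ht, htx⟩ := hT' U x hx
    exact V.upper htx (hT V (h ▸ ht))
  exact SetLike.ext fun x => ⟨key U V h x, key V U h.symm x⟩

/-! ### Injections from cardinality bounds -/

/-- If each of at most `c` many points is related to at least `c` many points, then there is an
injective choice function. -/
theorem exists_injective_of_forall_le_mk {X Y : Type u} (R : X → Y → Prop) {c : Cardinal.{u}}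
    (hX : #X ≤ c) (hR : ∀ x, c ≤ #{y // R x y}) :
    ∃ f : X → Y, Function.Injective f ∧ ∀ x, R x (f x) := by
  -- In a well-order of minimal type, fewer than `c` values are already taken at each stage, so a
  -- greedy choice succeeds.
  obtain ⟨_, _, hord⟩ := exists_ord_eq_type_lt X
  have step : ∀ (x : X) (g : ∀ x' : X, x' < x → Y), ∃ y, R x y ∧ ∀ x' h, g x' h ≠ y := by
    intro x g
    by_contra! hcon
    have hsub : #{y // R x y} ≤ #(Set.Iio x) := by
      choose h hlt hg using hcon
      refine mk_le_of_injective (f := fun y : {y // R x y} => ⟨h y.1 y.2, hlt y.1 y.2⟩) ?_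
      intro y z hyz
      have h1 := hg y.1 y.2
      have h2 := hg z.1 z.2
      have h3 : h y.1 y.2 = h z.1 z.2 := congrArg Subtype.val hyz
      ext
      rw [← h1, ← h2]
      congr 1
    have hlt : #(Set.Iio x) < #X := card_typein_lt (r := (· < ·)) x hord
    exact absurd ((hR x).trans hsub) (not_le.2 (hlt.trans_le hX))
  choose F hF hF' using step
  have wf : WellFounded ((· < ·) : X → X → Prop) := wellFounded_lt
  let f : X → Y := wf.fix F
  have hf : ∀ x, f x = F x fun x' _ => f x' := fun x => wf.fix_eq F x
  have hne : ∀ x x', x' < x → f x' ≠ f x := fun x x' h => by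
    rw [hf x]
    exact hF' x (fun x' _ => f x') x' h
  refine ⟨f, fun x x' h => ?_, fun x => ?_⟩
  · rcases lt_trichotomy x x' with hl | he | hl
    · exact absurd h (hne _ _ hl)
    · exact he
    · exact absurd h.symm (hne _ _ hl)
  · rw [hf x]
    exact hF x _

theorem exists_injective_of_fiberwise {X Y I : Type*} (g : X → I) (k : Y → I)
    (R : X → Y → Prop)
    (h : ∀ i, ∃ f : {x // g x = i} → {y // k y = i},
      Function.Injective f ∧ ∀ x : {x // g x = i}, R x.1 (f x).1) :
    ∃ f : X → Y, Function.Injective f ∧ ∀ x, R x (f x) := by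
  choose f hf hR using h
  refine ⟨fun x => f (g x) ⟨x, rfl⟩, fun x x' hx => ?_, fun x => hR _ ⟨x, rfl⟩⟩
  have key : ∀ i (hi : g x = i) (j) (hj : g x' = j), i = j →
      (f i ⟨x, hi⟩ : Y) = f j ⟨x', hj⟩ → x = x' := by
    rintro i hi j hj rfl he
    exact congrArg Subtype.val (hf i (Subtype.ext he))
  refine key _ rfl _ rfl ?_ hx
  rw [← (f (g x) ⟨x, rfl⟩).2, ← (f (g x') ⟨x', rfl⟩).2]
  exact congrArg k hx

theorem exists_injective_comp_eq_of_map_univ_eq {X Y P : Type*} [Fintype X] [Fintype Y]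
    (v : X → P) (w : Y → P)
    (h : Finset.univ.val.map v = Finset.univ.val.map w) :
    ∃ f : X → Y, Function.Injective f ∧ ∀ x, w (f x) = v x := by
  classical
  refine exists_injective_of_fiberwise v w (fun x y => w y = v x) fun p => ?_
  have hcard : Fintype.card {x // v x = p} = Fintype.card {y // w y = p} := by
    have := congrArg (Multiset.count p) h
    simpa [Multiset.count_map, Fintype.card_subtype, eq_comm, Finset.card_def] using this
  let e := Fintype.equivOfCardEq hcard
  exact ⟨e, e.injective, fun x => (e x).2.trans x.2.symm⟩

/-! ### Counting the points above a given one -/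

section UpCard

variable {P : Type u} [PartialOrder P] {X Y : Type u}

/-- The number of indices `x` with `p ≤ v x`. -/
noncomputable def upCard (v : X → P) (p : P) : Cardinal.{u} :=
  #{x // p ≤ v x}

open Classical in
/-- The number of indices `x` with `p ≤ v x` if it is infinite, and `0` otherwise. -/
noncomputable def infUpCard (v : X → P) (p : P) : Cardinal.{u} :=
  if ℵ₀ ≤ upCard v p then upCard v p else 0

theorem antitone_upCard (v : X → P) : Antitone (upCard v) := fun _ _ hpq =>
  mk_subtype_mono fun _ hx => hpq.trans hx

theorem upCard_le (v : X → P) (p : P) : upCard v p ≤ #X := mk_subtype_le _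

theorem antitone_infUpCard (v : X → P) : Antitone (infUpCard v) := by
  intro p q hpq
  have := antitone_upCard v hpq
  unfold infUpCard
  split_ifs with h1 h2
  · exact this
  · exact absurd (h1.trans this) h2
  · exact zero_le
  · exact le_rfl

theorem infUpCard_eq_zero {v : X → P} {p : P} : infUpCard v p = 0 ↔ upCard v p < ℵ₀ := by
  unfold infUpCard
  split_ifs with h
  · simp [h.not_gt, (aleph0_pos.trans_le h).ne']
  · simpa using h

theorem infUpCard_of_ne_zero {v : X → P} {p : P} (h : infUpCard v p ≠ 0) :
    infUpCard v p = upCard v p ∧ ℵ₀ ≤ upCard v p := by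
  rw [Ne, infUpCard_eq_zero, not_lt] at h
  exact ⟨if_pos h, h⟩

variable [WellQuasiOrderedLE P]

/-- Finitely many cones above points of `S` cover the preimage of `S`, so no regularity of `c` is
needed. -/
theorem mk_lt_of_forall_upCard_lt (v : X → P) {c : Cardinal.{u}} (hc : ℵ₀ ≤ c) (S : Set P)
    (hS : ∀ p ∈ S, upCard v p < c) : #{x // v x ∈ S} < c := by
  obtain ⟨T, hTS, hT⟩ := exists_finset_basis S
  have hsub : {x | v x ∈ S} ⊆ ⋃ t ∈ T, {x | t ≤ v x} := by
    intro x hx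
    obtain ⟨t, ht, htx⟩ := hT _ hx
    exact Set.mem_biUnion (x := t) ht htx
  refine (mk_le_mk_of_subset hsub).trans_lt ?_
  have hS' : ∀ t ∈ T, upCard v t < c := fun t ht => hS t (hTS ht)
  clear hsub hT hTS
  classical
  induction T using Finset.induction_on with
  | empty => simpa using aleph0_pos.trans_le hc
  | insert a T _ ih =>
    rw [Finset.set_biUnion_insert]
    refine (mk_union_le _ _).trans_lt (add_lt_of_lt hc ?_ ?_)
    · exact hS' a (Finset.mem_insert_self a T)
    · exact ih fun t ht => hS' t (Finset.mem_insert_of_mem ht)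

instance finite_infUpCard_eq_zero (v : X → P) : Finite {x // infUpCard v (v x) = 0} :=
  lt_aleph0_iff_finite.1 <| mk_lt_of_forall_upCard_lt v le_rfl {p | infUpCard v p = 0}
    fun _ hp => infUpCard_eq_zero.1 hp

theorem mk_infUpCard_eq_le (v : X → P) {c : Cardinal.{u}} (hc : c ≠ 0) :
    #{x // infUpCard v (v x) = c} ≤ c := by
  by_cases hne : Nonempty {x // infUpCard v (v x) = c}
  · obtain ⟨x, rfl⟩ := hne
    obtain ⟨h1, h2⟩ := infUpCard_of_ne_zero hc
    -- The strict bound is applied with the successor of the common level value.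
    refine lt_succ_iff.1 <| mk_lt_of_forall_upCard_lt v
      ((h2.trans_eq h1.symm).trans (le_succ _)) {p | infUpCard v p = infUpCard v (v x)} ?_
    intro p hp
    rw [Set.mem_ofPred_eq] at hp
    rw [← (infUpCard_of_ne_zero (hp ▸ hc)).1, hp]
    exact lt_succ _
  · rw [not_nonempty_iff] at hne
    simp

/-- Indices above `p` have level at most that of `p`; those of strictly smaller level are too few to
matter. -/
theorem le_mk_infUpCard_eq (v : X → P) (p : P) (hp : infUpCard v p ≠ 0) :
    infUpCard v p ≤ #{x : {x // infUpCard v (v x) = infUpCard v p} // p ≤ v x} := by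
  obtain ⟨h1, h2⟩ := infUpCard_of_ne_zero hp
  by_contra! hlt
  have hc : ℵ₀ ≤ infUpCard v p := h2.trans_eq h1.symm
  have hlow : #{x // v x ∈ {q | infUpCard v q < infUpCard v p}} < infUpCard v p := by
    refine mk_lt_of_forall_upCard_lt v hc _ fun q hq => ?_
    by_cases h0 : infUpCard v q = 0
    · exact (infUpCard_eq_zero.1 h0).trans_le hc
    · exact (infUpCard_of_ne_zero h0).1 ▸ hq
  have hmap : #{x // infUpCard v (v x) = infUpCard v p ∧ p ≤ v x} < infUpCard v p :=
    (mk_congr (Equiv.subtypeSubtypeEquivSubtypeInter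
      (fun x => infUpCard v (v x) = infUpCard v p) (fun x => p ≤ v x))).symm.trans_lt hlt
  have hsub : {x | p ≤ v x} ⊆ {x | v x ∈ {q | infUpCard v q < infUpCard v p}} ∪
      {x | infUpCard v (v x) = infUpCard v p ∧ p ≤ v x} := by
    intro x hx
    rcases (antitone_infUpCard v hx).lt_or_eq with h | h
    · exact Or.inl h
    · exact Or.inr ⟨h, hx⟩
  have := ((mk_le_mk_of_subset hsub).trans (mk_union_le _ _)).trans_lt
    (add_lt_of_lt hc hlow hmap)
  exact this.ne h1.symm

/-- The finite multiset of the values with only finitely many values above them. -/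
noncomputable def finitePart (v : X → P) : Multiset P :=
  (@Finset.univ {x // infUpCard v (v x) = 0} (Fintype.ofFinite _)).val.map
    fun x : {x // infUpCard v (v x) = 0} => v x

/-- Level `0` is matched by equal multisets. At level `c ≠ 0` there are at most `c` sources, each
with at least `c` targets of the same level. -/
theorem exists_injective_le_of_infUpCard_eq (v : X → P) (w : Y → P)
    (h : infUpCard v = infUpCard w) (hfin : finitePart v = finitePart w) :
    ∃ f : X → Y, Function.Injective f ∧ ∀ x, v x ≤ w (f x) := by
  refine exists_injective_of_fiberwise (fun x => infUpCard v (v x))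
    (fun y => infUpCard w (w y)) (fun x y => v x ≤ w y) fun c => ?_
  by_cases hc : c = 0
  · subst hc
    obtain ⟨f, hf, hf'⟩ := @exists_injective_comp_eq_of_map_univ_eq _ _ _
      (Fintype.ofFinite {x // infUpCard v (v x) = 0})
      (Fintype.ofFinite {y // infUpCard w (w y) = 0}) (fun x => v x) (fun y => w y) hfin
    exact ⟨f, hf, fun x => (hf' x).ge⟩
  · refine exists_injective_of_forall_le_mk
      (fun (x : {x // infUpCard v (v x) = c}) (y : {y // infUpCard w (w y) = c}) => v x ≤ w y)
      (mk_infUpCard_eq_le v hc) ?_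
    rintro ⟨x, hx⟩
    rw [h] at hx
    subst hx
    exact le_mk_infUpCard_eq w (v x) hc

end UpCard

/-! ### Counting the classes of subsets -/

theorem mk_le_of_lt_aleph {μ κ : Cardinal.{u}} (hμ : ℵ₀ ≤ μ)
    (hκ : κ < ℵ_ (succ μ).ord) :
    #{c : Cardinal.{u} // c ≤ κ ∧ (c = 0 ∨ ℵ₀ ≤ c)} ≤ lift.{u + 1} μ := by
  -- Passing to `max κ ℵ₀` makes it an aleph even for finite `κ`.
  have hmax : max κ ℵ₀ < ℵ_ (succ μ).ord := by
    refine max_lt hκ ?_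
    rw [← aleph_zero, aleph_lt_aleph]
    exact (isSuccLimit_ord (hμ.trans (le_succ μ))).bot_lt
  obtain ⟨o, ho⟩ := mem_range_aleph_iff.2 (le_max_right κ ℵ₀)
  rw [← ho, aleph_lt_aleph, lt_ord, lt_succ_iff] at hmax
  have hsub : {c : Cardinal.{u} | c ≤ κ ∧ (c = 0 ∨ ℵ₀ ≤ c)} ⊆
      insert 0 ((ℵ_ ·) '' Set.Iio (succ o)) := by
    rintro c ⟨hc, rfl | hc'⟩
    · exact Set.mem_insert _ _
    · obtain ⟨a, rfl⟩ := mem_range_aleph_iff.2 hc'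
      refine Set.mem_insert_of_mem _ ⟨a, ?_, rfl⟩
      rw [Set.mem_Iio, lt_succ_iff, ← aleph_le_aleph, ho]
      exact hc.trans (le_max_left _ _)
  have hμ' : ℵ₀ ≤ lift.{u + 1} μ := by simpa using hμ
  refine (mk_le_mk_of_subset hsub).trans (mk_insert_le.trans ?_)
  refine add_le_of_le hμ' (mk_image_le.trans ?_) (one_le_aleph0.trans hμ')
  rw [Cardinal.mk_Iio_ordinal, lift_le, Order.succ_eq_add_one, Ordinal.card_add_one]
  exact add_le_of_le hμ hmax (one_le_aleph0.trans hμ)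

section Code

variable {P : Type u} [PartialOrder P] {X Y : Type u} {κ : Cardinal.{u}}

/-- The upper set of the pairs `(p, c)` with `infUpCard v p ≤ c`. -/
noncomputable def infUpCardEpigraph (κ : Cardinal.{u}) (v : X → P) :
    UpperSet (P × {c : Cardinal.{u} // c ≤ κ ∧ (c = 0 ∨ ℵ₀ ≤ c)}) where
  carrier := {x | infUpCard v x.1 ≤ x.2}
  upper' _ _ hxy hx := (antitone_infUpCard v hxy.1).trans (le_trans hx hxy.2)

theorem infUpCard_mem (v : X → P) (hX : #X ≤ κ) (p : P) :
    infUpCard v p ≤ κ ∧ (infUpCard v p = 0 ∨ ℵ₀ ≤ infUpCard v p) := by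
  by_cases h : infUpCard v p = 0
  · simp [h]
  · obtain ⟨h1, h2⟩ := infUpCard_of_ne_zero h
    rw [h1]
    exact ⟨(upCard_le v p).trans hX, Or.inr h2⟩

theorem infUpCard_eq_of_epigraph_eq (v : X → P) (w : Y → P) (hX : #X ≤ κ) (hY : #Y ≤ κ)
    (h : infUpCardEpigraph κ v = infUpCardEpigraph κ w) : infUpCard v = infUpCard w := by
  have key : ∀ (p : P) (c : {c : Cardinal.{u} // c ≤ κ ∧ (c = 0 ∨ ℵ₀ ≤ c)}),
      infUpCard v p ≤ c.1 ↔ infUpCard w p ≤ c.1 := fun p c =>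
    SetLike.ext_iff.1 h (p, c)
  funext p
  -- The values themselves are admissible second coordinates, so the epigraph detects them.
  exact le_antisymm ((key p ⟨_, infUpCard_mem w hY p⟩).2 le_rfl)
    ((key p ⟨_, infUpCard_mem v hX p⟩).1 le_rfl)

end Code

theorem numClasses_subsetsLE_le {μ : Cardinal.{u}} (hμ : ℵ₀ ≤ μ) {Q : Type u} [Preorder Q]
    [WellQuasiOrderedLE Q] (hQμ : numClasses Q = μ) {κ : Cardinal.{u}}
    (hκ : κ < ℵ_ (succ μ).ord) : numClasses (SubsetsLE Q κ) ≤ μ := by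
  let P := Antisymmetrization Q (· ≤ ·)
  let C := {c : Cardinal.{u} // c ≤ κ ∧ (c = 0 ∨ ℵ₀ ≤ c)}
  have hP : #P = μ := hQμ
  have : WellQuasiOrderedLE P :=
    Monotone.wellQuasiOrderedLE_of_wellQuasiOrderedLE_of_surjective
      (f := toAntisymmetrization (α := Q) (· ≤ ·)) toAntisymmetrization_mono
      Quotient.mk_surjective
  have : Infinite P := infinite_iff.2 (hP ▸ hμ)
  have : Nonempty C := ⟨⟨0, zero_le, Or.inl rfl⟩⟩
  have hμ' : ℵ₀ ≤ lift.{u + 1} μ := by simpa using hμ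
  let v : ∀ A : SubsetsLE Q κ, A.carrier → P := fun A a => toAntisymmetrization (· ≤ ·) (a : Q)
  let code : SubsetsLE Q κ → UpperSet (P × C) × Multiset P := fun A =>
    (infUpCardEpigraph κ (v A), finitePart (v A))
  have hcode : ∀ A B, code A = code B → A ≤ B := by
    intro A B h
    rw [Prod.mk.injEq] at h
    exact exists_injective_le_of_infUpCard_eq (v A) (v B)
      (infUpCard_eq_of_epigraph_eq _ _ A.card_le B.card_le h.1) h.2
  have hinj : Function.Injective fun a : Antisymmetrization (SubsetsLE Q κ) (· ≤ ·) =>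
      code (ofAntisymmetrization (· ≤ ·) a) := by
    intro a b h
    rw [← toAntisymmetrization_ofAntisymmetrization (· ≤ ·) a,
      ← toAntisymmetrization_ofAntisymmetrization (· ≤ ·) b]
    exact Quotient.sound ⟨hcode _ _ h, hcode _ _ h.symm⟩
  -- The cardinals in `C` live one universe higher.
  rw [← lift_le.{u + 1}]
  have hle := lift_mk_le_lift_mk_of_injective hinj
  rw [lift_id'.{u, u + 1}] at hle
  refine hle.trans ?_
  rw [mk_prod]
  refine mul_le_of_le hμ' ?_ ?_
  · have : #(UpperSet (P × C)) ≤ lift.{u + 1} μ := by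
      refine mk_upperSet_le.trans ?_
      rw [mk_prod, hP]
      refine mul_le_of_le hμ' ?_ ?_
      · simp
      · rw [lift_id'.{u, u + 1}]
        exact mk_le_of_lt_aleph hμ hκ
    rwa [lift_id'.{u, u + 1}]
  · rw [mk_multiset_of_infinite, hP]

theorem numClasses_le_numClasses_subsetsLE {Q : Type u} [Preorder Q] {κ : Cardinal.{u}}
    (hκ : 1 ≤ κ) : numClasses Q ≤ numClasses (SubsetsLE Q κ) := by
  let s : Q → SubsetsLE Q κ := fun q => ⟨{q}, by simpa using hκ⟩
  have hs : ∀ p q, s p ≤ s q ↔ p ≤ q := by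
    intro p q
    constructor
    · rintro ⟨f, -, hf⟩
      have h1 := hf ⟨p, rfl⟩
      have h2 : (f ⟨p, rfl⟩ : Q) = q := (f ⟨p, rfl⟩).2
      rwa [h2] at h1
    · intro h
      refine ⟨fun _ => ⟨q, rfl⟩, fun a b _ => Subtype.ext (a.2.trans b.2.symm), fun a => ?_⟩
      have h2 : (a : Q) = p := a.2
      rwa [h2]
  refine mk_le_of_injective (f := fun a => toAntisymmetrization (· ≤ ·)
    (s (ofAntisymmetrization (· ≤ ·) a))) fun a b h => ?_
  have h' := Quotient.exact h
  rw [← toAntisymmetrization_ofAntisymmetrization (· ≤ ·) a,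
    ← toAntisymmetrization_ofAntisymmetrization (· ≤ ·) b]
  exact Quotient.sound ⟨(hs _ _).1 h'.1, (hs _ _).1 h'.2⟩

theorem mainTheorem4 (μ : Cardinal.{u}) (hμ : ℵ₀ ≤ μ)
    (Q : Type u) [Preorder Q] (hQ : IsBetterQuasiOrder Q) (hQμ : numClasses Q = μ)
    (κ : Cardinal.{u}) (hκ_pos : 1 ≤ κ) (hκ : κ < ℵ_ (Order.succ μ).ord) :
    numClasses (SubsetsLE Q κ) = μ := by
  have := hQ.wellQuasiOrderedLE
  refine le_antisymm (numClasses_subsetsLE_le hμ hQμ hκ) ?_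
  rw [← hQμ]
  exact numClasses_le_numClasses_subsetsLE hκ_pos
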